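/- For simple graphs $G_1,\dots,G_k$, let $R(G_1,\dots,G_k)$ denote the multicolor Ramsey number, i.e. the smallest positive integer $N$ such that, whenever the edges of the complete graph $K_N$ are partitioned into $k$ (possibly empty) color classes forming graphs $H_1,\dots,H_k$ on the vertex set of $K_N$, at least one $H_i$ has a subgraph isomorphic to $G_i$. Let $S_t=K_{1,t}$ denote the star with $t$ edges and $nK_2$ the matching consisting of $n$ pairwise disjoint edges. Let $s\ge 0$ and $c\ge 1$, let $t_1,\dots,t_s$ and $n_1\ge n_2\ge\cdots\ge n_c$ be positive integers, and put $\Sigma=\sum_{i=1}^{s}(t_i-1)$ and $r=R(S_{t_1},\dots,S_{t_s})$. If $c=1$, put $n_2=0$, so that $\max\{n_1,2n_2\}=n_1$. Then $$R(S_{t_1},\dots,S_{t_s},n_1K_2,\dots,n_cK_2)=\max\{r+\delta,\,n_1\}+\sum_{i=1}^{c}(n_i-1)+1,$$ where $\delta=0$ if $\Sigma<\max\{n_1,2n_2\}$, $\Sigma$ is even and at least one $t_i$ is even, and $\delta=-1$ otherwise. (For $s=0$ one has $\Sigma=0$, $r=2$ and $\delta=-1$.) -/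

import Mathlib

/-- A simple graph bundled with its vertex type. -/
abbrev BundledGraph : Type 1 := Σ V : Type, SimpleGraph V

/-- `H → (G i)_{i : ι}`: for every partition of the edges of `H` into (possibly empty) colour
classes indexed by `ι`, some colour class `i` has a subgraph isomorphic to `G i`. -/
def Arrows {W : Type} (H : SimpleGraph W) {ι : Type} (G : ι → BundledGraph) : Prop :=
  ∀ C : H.EdgeLabeling ι, ∃ i : ι, (G i).2.IsContained (C.labelGraph i)

/-- The multicolour Ramsey number of the family `G`: the smallest positive integer `N` such that
`K_N → (G i)_{i : ι}`. -/
noncomputable def ramseyNumber {ι : Type} (G : ι → BundledGraph) : ℕ :=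
  sInf {N : ℕ | 0 < N ∧ Arrows (⊤ : SimpleGraph (Fin N)) G}

/-- The star `S_t` with `t` edges, i.e. `K_{1,t}`. -/
def star_S (t : ℕ) : BundledGraph :=
  ⟨Fin 1 ⊕ Fin t, completeBipartiteGraph (Fin 1) (Fin t)⟩

/-- The stripe `nK₂`: `n` pairwise disjoint edges `{(k, 0), (k, 1)}`, `k < n`. -/
def stripe (n : ℕ) : BundledGraph :=
  ⟨Fin n × Fin 2,
    { Adj := fun p q => p.1 = q.1 ∧ p.2 ≠ q.2
      symm := ⟨fun _ _ h => ⟨h.1.symm, h.2.symm⟩⟩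
      loopless := ⟨fun _ h => h.2 rfl⟩ }⟩

/-- The second entry `n₂` of a finite sequence `n₁, …, n_c`, read as `0` if there is none, so that
`max {n₁, 2n₂} = n₁` when `c = 1`. -/
def secondEntry {c : ℕ} (n : Fin c → ℕ) : ℕ :=
  if h : 1 < c then n ⟨1, h⟩ else 0

/-
By the Tutte–Berge formula, a graph without `n` disjoint edges has a vertex set `U` off which its
components contain fewer than `n - |U|` disjoint pairs of vertices. Deleting these sets for all the
stripe colours, one may assume that every stripe colour is a partition with at most `b i < n i`
disjoint pairs inside its classes. Such a partition has at most one class of more than `b i + 1`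
vertices, and if this dominant class has `b i + 1 + e i` vertices, then every other class has at
most `b i + 1 - e i`. Cliques of at most `2 * b i + 1` vertices are too small to cover all pairs of
vertices, so some two vertices are in no common dominant class, and one of them has degree at most
`∑ b i` in the stripe colours. The stars must absorb the rest, which bounds the number of vertices.

In the exceptional case (`Σ` even, some `t i` even, no large stripe) one vertex less suffices. Now
every vertex has degree at least `∑ b i` in the stripe colours. Summing `± e i`, with the sign of
membership in the dominant class, over all vertices forces `e i = 0`; then all classes have
`b i + 1` elements, and by parity they are singletons. So the stars alone decompose a complete
graph on `Σ + 1` vertices, an odd number, into regular graphs, one of which has odd degree.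

For the lower bounds, complete graphs are factored into perfect matchings or 2-factors, which are
distributed among the stars. Such a colouring, or one with one or two cliques of stripe colours, is
extended by new vertices for every stripe, all of whose edges get that stripe's colour.
-/

section Ramsey

open Finset SimpleGraph
open scoped Classical

variable {V W ι κ : Type}

theorem Arrows.of_card_le [Fintype V] [Fintype W] {G : ι → BundledGraph}
    (h : Arrows (⊤ : SimpleGraph V) G) (hVW : Fintype.card V ≤ Fintype.card W) :
    Arrows (⊤ : SimpleGraph W) G := by
  obtain ⟨f⟩ : Nonempty (V ↪ W) := Function.Embedding.nonempty_of_card_le hVW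
  intro C
  obtain ⟨i, hi⟩ := h (TopEdgeLabeling.pullback C f)
  refine ⟨i, hi.trans ⟨⟨⟨f, fun {a b} hab => ?_⟩, f.injective⟩⟩⟩
  rw [TopEdgeLabeling.labelGraph_adj] at hab ⊢
  exact ⟨f.injective.ne hab.1, hab.2⟩

theorem arrows_top_iff {G : ι → BundledGraph} :
    Arrows (⊤ : SimpleGraph V) G ↔
      ∀ H : ι → SimpleGraph V, ⨆ i, H i = ⊤ → ∃ i, (G i).2 ⊑ H i := by
  constructor
  · intro h H hH
    have hcol (e : (⊤ : SimpleGraph V).edgeSet) : ∃ i, e.1 ∈ (H i).edgeSet := by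
      rw [← Set.mem_iUnion, ← edgeSet_iSup, hH]
      exact e.2
    choose C hC using hcol
    obtain ⟨i, hi⟩ := h C
    refine ⟨i, hi.trans (IsContained.of_le fun x y hxy => ?_)⟩
    obtain ⟨hne, rfl⟩ := (TopEdgeLabeling.labelGraph_adj x y).1 hxy
    exact hC ⟨s(x, y), hne⟩
  · intro h C
    exact h C.labelGraph (EdgeLabeling.iSup_labelGraph C)

theorem ramseyNumber_eq_succ {G : ι → BundledGraph} {N : ℕ}
    (harrows : Arrows (⊤ : SimpleGraph (Fin (N + 1))) G)
    (hnot : ¬ Arrows (⊤ : SimpleGraph (Fin N)) G) : ramseyNumber G = N + 1 := by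
  apply le_antisymm
  · exact Nat.sInf_le ⟨N.succ_pos, harrows⟩
  · refine le_csInf ⟨N + 1, N.succ_pos, harrows⟩ ?_
    rintro M ⟨-, hM⟩
    by_contra! hlt
    exact hnot (hM.of_card_le (by simpa using Nat.le_of_lt_succ hlt))

/-! ### Stars and stripes as subgraphs -/

theorem stripe_isContained_of_disjoint_edges {n : ℕ} {H : SimpleGraph V} (E : Finset (Sym2 V))
    (hE : ∀ e ∈ E, e ∈ H.edgeSet) (hdisj : ∀ e ∈ E, ∀ e' ∈ E, ∀ v ∈ e, v ∈ e' → e = e')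
    (hn : n ≤ #E) : (stripe n).2 ⊑ H := by
  obtain ⟨g⟩ : Nonempty (Fin n ↪ E) :=
    Function.Embedding.nonempty_of_card_le (by simpa using hn)
  let f (p : Fin n × Fin 2) : V := if p.2 = 0 then (g p.1).1.out.1 else (g p.1).1.out.2
  have hmem (p : Fin n × Fin 2) : f p ∈ (g p.1).1 := by
    dsimp only [f]
    split_ifs
    · exact Sym2.out_fst_mem _
    · exact Sym2.out_snd_mem _
  have hadj (k : Fin n) : H.Adj (g k).1.out.1 (g k).1.out.2 := by
    rw [← mem_edgeSet]
    convert hE _ (g k).2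
    exact Quot.out_eq _
  refine ⟨⟨⟨f, ?_⟩, ?_⟩⟩
  · rintro ⟨k, a⟩ ⟨l, b⟩ ⟨rfl : k = l, hab : a ≠ b⟩
    fin_cases a <;> fin_cases b
    · exact absurd rfl hab
    · exact hadj k
    · exact (hadj k).symm
    · exact absurd rfl hab
  · rintro ⟨k, a⟩ ⟨l, b⟩ (hab : f (k, a) = f (l, b))
    obtain rfl : k = l := g.injective <| Subtype.ext <|
      hdisj _ (g k).2 _ (g l).2 _ (hmem (k, a)) (hab ▸ hmem (l, b))
    fin_cases a <;> fin_cases b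
    · rfl
    · exact absurd hab (hadj k).ne
    · exact absurd hab (hadj k).ne'
    · rfl

theorem stripe_isContained_induce_compl {n k : ℕ} {G : SimpleGraph V} (X : Finset V)
    (hX : #X ≤ k) (h : (stripe (n + k)).2 ⊑ G) : (stripe n).2 ⊑ G.induce (↑X)ᶜ := by
  obtain ⟨f⟩ := h
  let bad : Finset (Fin (n + k)) := ({p | f p ∈ X} : Finset (Fin (n + k) × Fin 2)).image Prod.fst
  have hbad : #bad ≤ k := by
    refine (card_image_le.trans ?_).trans hX
    exact card_le_card_of_injOn f (fun p hp => (mem_filter.1 hp).2) f.injective.injOn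
  have hgood : ∀ i ∈ badᶜ, ∀ a, f (i, a) ∈ ((↑X)ᶜ : Set V) := fun i hi a ha =>
    mem_compl.1 hi (mem_image.2 ⟨(i, a), mem_filter.2 ⟨mem_univ _, ha⟩, rfl⟩)
  obtain ⟨g⟩ : Nonempty (Fin n ↪ (badᶜ : Finset _)) :=
    Function.Embedding.nonempty_of_card_le (by
      rw [Fintype.card_fin, Fintype.card_coe, card_compl, Fintype.card_fin]
      omega)
  refine ⟨⟨⟨fun p => ⟨f (g p.1, p.2), hgood _ (g p.1).2 _⟩, ?_⟩, ?_⟩⟩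
  · rintro p q ⟨hpq, hne⟩
    exact f.toHom.map_adj ⟨congrArg (fun i => (g i).1) hpq, hne⟩
  · intro p q hpq
    have h := f.injective (congrArg Subtype.val hpq)
    exact Prod.ext (g.injective (Subtype.ext (Prod.ext_iff.1 h).1)) (Prod.ext_iff.1 h).2

section Fintype

variable [Fintype V]

theorem star_isContained_iff {t : ℕ} {H : SimpleGraph V} :
    (star_S t).2 ⊑ H ↔ ∃ v, t ≤ H.degree v := by
  constructor
  · rintro ⟨f⟩
    refine ⟨f (Sum.inl 0), ?_⟩
    let leaf : Fin t ↪ V := Function.Embedding.inr.trans ⟨f, f.injective⟩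
    have hleaf : univ.map leaf ⊆ H.neighborFinset (f (Sum.inl 0)) := by
      intro x hx
      obtain ⟨i, -, rfl⟩ := mem_map.1 hx
      rw [mem_neighborFinset]
      exact f.toHom.map_adj (by simp [star_S])
    simpa using card_le_card hleaf
  · rintro ⟨v, hv⟩
    obtain ⟨leaf⟩ : Nonempty (Fin t ↪ H.neighborFinset v) :=
      Function.Embedding.nonempty_of_card_le (by
        rwa [Fintype.card_fin, Fintype.card_coe, card_neighborFinset_eq_degree])
    have hadj (i : Fin t) : H.Adj v (leaf i) := (H.mem_neighborFinset _ _).1 (leaf i).2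
    refine ⟨⟨⟨Sum.elim (fun _ => v) (fun i => leaf i), ?_⟩, ?_⟩⟩
    · rintro (a | a) (b | b) hab
      · simp [star_S] at hab
      · exact hadj b
      · exact (hadj a).symm
      · simp [star_S] at hab
    · rintro (a | a) (b | b) hab
      · exact congrArg Sum.inl (Subsingleton.elim a b)
      · exact absurd hab (hadj b).ne
      · exact absurd hab (hadj a).ne'
      · exact congrArg Sum.inr (leaf.injective (Subtype.ext hab))

theorem two_mul_le_sum_of_stripe_isContained {n : ℕ} {H : SimpleGraph V} (w : V → ℕ)
    (hw : ∀ x y, H.Adj x y → 2 ≤ w x + w y) (h : (stripe n).2 ⊑ H) : 2 * n ≤ ∑ v, w v := by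
  obtain ⟨f⟩ := h
  let g : Fin n × Fin 2 ↪ V := ⟨f, f.injective⟩
  calc 2 * n = ∑ _k : Fin n, 2 := by simp [mul_comm]
    _ ≤ ∑ k : Fin n, ∑ e : Fin 2, w (g (k, e)) := by
        refine sum_le_sum fun k _ => ?_
        rw [Fin.sum_univ_two]
        exact hw _ _ (f.toHom.map_adj (by simp [stripe]))
    _ = ∑ p : Fin n × Fin 2, w (g p) := (Fintype.sum_prod_type fun p => w (g p)).symm
    _ = ∑ v ∈ univ.map g, w v := by rw [sum_map]
    _ ≤ ∑ v, w v := sum_le_sum_of_subset (subset_univ _)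

theorem stripe_isContained_of_isPerfectMatching {n : ℕ} {H : SimpleGraph V} {M : H.Subgraph}
    (hM : M.IsPerfectMatching) (hn : 2 * n ≤ Fintype.card V) : (stripe n).2 ⊑ H := by
  have hcard : 2 * #M.spanningCoe.edgeFinset = Fintype.card V := by
    rw [← sum_degrees_eq_twice_card_edges, ← card_univ, card_eq_sum_ones]
    refine sum_congr rfl fun v _ => ?_
    rw [Subgraph.degree_spanningCoe]
    exact Subgraph.isPerfectMatching_iff_forall_degree.1 hM v
  refine stripe_isContained_of_disjoint_edges M.spanningCoe.edgeFinset
    (fun e he => edgeSet_mono M.spanningCoe_le (mem_edgeFinset.1 he)) ?_ (by omega)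
  intro e he e' he' v hv hv'
  obtain ⟨x, rfl⟩ := Sym2.mem_iff_exists.1 hv
  obtain ⟨y, rfl⟩ := Sym2.mem_iff_exists.1 hv'
  rw [mem_edgeFinset, mem_edgeSet] at he he'
  rw [hM.1.eq_of_adj_left he he']

end Fintype

/-! ### Stripe-free graphs and partitions -/

/-- The join of a graph with the complete graph on `K`. -/
def joinTop (H : SimpleGraph V) (K : Type) : SimpleGraph (V ⊕ K) :=
  (Hᶜ ⊕g (⊥ : SimpleGraph K))ᶜ

theorem joinTop_adj_inl {H : SimpleGraph V} {K : Type} {x y : V} :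
    (joinTop H K).Adj (Sum.inl x) (Sum.inl y) ↔ H.Adj x y := by
  rw [joinTop, compl_adj, sum_adj_inl, compl_adj, Sum.inl_injective.ne_iff]
  exact ⟨fun h => not_not.1 fun hxy => h.2 ⟨h.1, hxy⟩, fun h => ⟨h.ne, fun hxy => hxy.2 h⟩⟩

theorem joinTop_adj_inr {H : SimpleGraph V} {K : Type} {k : K} {x : V ⊕ K} (hx : Sum.inr k ≠ x) :
    (joinTop H K).Adj (Sum.inr k) x := by
  rcases x with x | x
  · simp [joinTop]
  · simpa [joinTop] using hx

theorem stripe_isContained_of_joinTop {n : ℕ} {H : SimpleGraph V} {K : Type} [Fintype K]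
    (h : (stripe (n + Fintype.card K)).2 ⊑ joinTop H K) : (stripe n).2 ⊑ H := by
  refine (stripe_isContained_induce_compl (univ.map Function.Embedding.inr) (by simp) h).trans ?_
  have hleft (x : ((↑((univ : Finset K).map (.inr : K ↪ V ⊕ K)))ᶜ : Set (V ⊕ K))) :
      ∃ v : V, x.1 = Sum.inl v := by
    rcases x with ⟨v | k, hx⟩
    · exact ⟨v, rfl⟩
    · simp at hx
  choose f hf using hleft
  refine ⟨⟨⟨f, fun {x y} hxy => ?_⟩, fun x y hxy => ?_⟩⟩
  · rwa [comap_adj, Function.Embedding.subtype_apply, Function.Embedding.subtype_apply, hf, hf,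
      joinTop_adj_inl] at hxy
  · exact Subtype.ext ((hf x).trans ((congrArg Sum.inl hxy).trans (hf y).symm))

/-- The greatest number of disjoint pairs of vertices that `p` identifies, where a map `p` on the
vertices stands for the partition of the vertices into its fibres. -/
noncomputable def pairNumber {L : Type*} (p : V → L) : ℕ :=
  ∑ᶠ l, (p ⁻¹' {l}).ncard / 2

section Fintype

variable [Fintype V] [Fintype W]

theorem pairNumber_eq_sum {L : Type*} (p : V → L) :
    pairNumber p = ∑ l ∈ univ.image p, #{v | p v = l} / 2 := by
  have hfibre (l : L) : (p ⁻¹' {l}).ncard = #{v | p v = l} := by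
    rw [← Set.ncard_coe_finset]
    congr 1
    ext v
    simp
  simp only [pairNumber, hfibre]
  refine finsum_eq_sum_of_support_subset _ fun l hl => ?_
  obtain ⟨v, hv⟩ : ({v | p v = l} : Finset V).Nonempty := by
    by_contra hempty
    simp [not_nonempty_iff_eq_empty.1 hempty] at hl
  exact mem_coe.2 (mem_image.2 ⟨v, mem_univ v, (mem_filter.1 hv).2⟩)

theorem two_mul_pairNumber_add_card_odd {L : Type*} (p : V → L) :
    2 * pairNumber p + #{l ∈ univ.image p | Odd #{v | p v = l}} = Fintype.card V := by
  rw [card_filter, pairNumber_eq_sum, mul_sum, ← sum_add_distrib, ← card_univ (α := V),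
    card_eq_sum_card_fiberwise (f := p) (t := univ.image p) (by simp)]
  refine sum_congr rfl fun l _ => ?_
  split_ifs with h
  · exact Nat.two_mul_div_two_add_one_of_odd h
  · exact Nat.two_mul_div_two_of_even (Nat.not_odd_iff_even.1 h)

theorem pairNumber_le_of_refines {L L' : Type*} {p : V → L} {q : W → L'} (f : V ↪ W)
    (hf : ∀ x y, p x = p y → q (f x) = q (f y)) : pairNumber p ≤ pairNumber q := by
  rcases isEmpty_or_nonempty V with hV | ⟨⟨v₀⟩⟩
  · simp [pairNumber_eq_sum]
  have : Nonempty L' := ⟨q (f v₀)⟩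
  obtain ⟨g, hg⟩ := (Function.factorsThrough_iff (f := p) (q ∘ f)).1 hf
  have hgp (v : V) : g (p v) = q (f v) := (congrFun hg v).symm
  have hmaps : ∀ l ∈ univ.image p, g l ∈ univ.image q := by
    intro l hl
    obtain ⟨v, -, rfl⟩ := mem_image.1 hl
    exact mem_image.2 ⟨f v, mem_univ _, (hgp v).symm⟩
  rw [pairNumber_eq_sum, pairNumber_eq_sum, ← sum_fiberwise_of_maps_to hmaps]
  refine sum_le_sum fun m _ => ?_
  rw [Nat.le_div_iff_mul_le two_pos, sum_mul]
  calc ∑ l ∈ univ.image p with g l = m, #{v | p v = l} / 2 * 2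
      ≤ ∑ l ∈ univ.image p with g l = m, #{v | p v = l} :=
        sum_le_sum fun l _ => Nat.div_mul_le_self _ _
    _ = #{v | g (p v) = m} := by
        rw [card_eq_sum_card_fiberwise (f := p) (t := {l ∈ univ.image p | g l = m})
          (fun v hv => by simpa using hv)]
        refine sum_congr rfl fun l hl => ?_
        rw [filter_filter]
        congr 1
        ext v
        have := (mem_filter.1 hl).2
        aesop
    _ ≤ #{w | q w = m} :=
        card_le_card_of_injOn f (fun v hv => by simpa [hgp] using hv) f.injective.injOn

theorem card_odd_fibres_connectedComponentMk (G : SimpleGraph V) :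
    #{c ∈ univ.image G.connectedComponentMk | Odd #{v | G.connectedComponentMk v = c}} =
      G.oddComponents.ncard := by
  rw [← Set.ncard_coe_finset]
  congr 1
  ext c
  have hsupp : c.supp.ncard = #{v | G.connectedComponentMk v = c} := by
    rw [← Set.ncard_coe_finset]
    congr 1
    ext v
    simp
  obtain ⟨v, hv⟩ := c.exists_rep
  simpa [hsupp] using fun _ => ⟨v, hv⟩

theorem exists_two_mul_card_add_pairNumber_lt {G : SimpleGraph V}
    (h : ∀ M : G.Subgraph, ¬ M.IsPerfectMatching) :
    ∃ U : Finset V, 2 * (#U + pairNumber (G.induce (↑U)ᶜ).connectedComponentMk) <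
      Fintype.card V := by
  obtain ⟨u, hu⟩ : ∃ u, G.IsTutteViolator u := by
    by_contra! hno
    obtain ⟨M, hM⟩ := tutte.2 hno
    exact h M hM
  lift u to Finset V using u.toFinite
  let K := ((⊤ : G.Subgraph).deleteVerts ↑u).coe
  have hodd : #u < K.oddComponents.ncard := by rwa [← Set.ncard_coe_finset]
  let f : ((↑u)ᶜ : Set V) ↪ ((⊤ : G.Subgraph).deleteVerts ↑u).verts :=
    Function.Embedding.subtypeMap (Function.Embedding.refl V) fun v hv => ⟨Set.mem_univ v, hv⟩
  have hle : pairNumber (G.induce (↑u)ᶜ).connectedComponentMk ≤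
      pairNumber K.connectedComponentMk := by
    refine pairNumber_le_of_refines f fun x y hxy => ?_
    let φ : G.induce (↑u)ᶜ →g K := ⟨f, fun {x y} hxy => by simpa [K, f] using ⟨x.2, y.2, hxy⟩⟩
    exact ConnectedComponent.sound ((ConnectedComponent.exact hxy).map φ)
  have hid := two_mul_pairNumber_add_card_odd K.connectedComponentMk
  rw [card_odd_fibres_connectedComponentMk] at hid
  have hcard : Fintype.card ((⊤ : G.Subgraph).deleteVerts ↑u).verts + #u = Fintype.card V := by
    rw [← card_univ (α := V), ← card_sdiff_add_card_eq_card (subset_univ u), ← Set.toFinset_card]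
    congr 2
    ext v
    simp
  exact ⟨u, by omega⟩

theorem pairNumber_le_card_div_two {L : Type*} (p : V → L) :
    pairNumber p ≤ Fintype.card V / 2 := by
  have := two_mul_pairNumber_add_card_odd p
  omega

theorem card_div_two_le_pairNumber {L : Type*} [Subsingleton L] (p : V → L) :
    Fintype.card V / 2 ≤ pairNumber p := by
  rcases isEmpty_or_nonempty V with hV | hV
  · simp
  · have hle := pairNumber_le_of_refines (p := fun _ : V => ()) (q := p) (.refl V)
      fun _ _ _ => Subsingleton.elim _ _
    simpa [pairNumber_eq_sum, image_const univ_nonempty] using hle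

theorem card_div_two_le_of_inr_notMem {H : SimpleGraph V} {K : Type} [Fintype K]
    {u : Finset (V ⊕ K)} {k : K} (hk : Sum.inr k ∉ u) :
    Fintype.card (V ⊕ K) / 2 ≤
      #u + pairNumber ((joinTop H K).induce (↑u)ᶜ).connectedComponentMk := by
  let apex : ((↑u)ᶜ : Set (V ⊕ K)) := ⟨Sum.inr k, hk⟩
  have hreach (x) : ((joinTop H K).induce (↑u)ᶜ).Reachable apex x := by
    rcases eq_or_ne apex x with rfl | hx
    · rfl
    · exact Adj.reachable (joinTop_adj_inr fun h => hx (Subtype.ext h))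
  have hconn : ((joinTop H K).induce (↑u)ᶜ).Preconnected := fun x y =>
    (hreach x).symm.trans (hreach y)
  have := hconn.subsingleton_connectedComponent
  have hle := card_div_two_le_pairNumber ((joinTop H K).induce (↑u)ᶜ).connectedComponentMk
  have hcard := Set.ncard_add_ncard_compl (u : Set (V ⊕ K))
  rw [Set.ncard_coe_finset, ← Nat.card_coe_set_eq, Nat.card_eq_fintype_card,
    Nat.card_eq_fintype_card] at hcard
  omega

theorem exists_card_add_pairNumber_lt {H : SimpleGraph V} {n : ℕ} (h : ¬ (stripe n).2 ⊑ H) :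
    ∃ U : Finset V, #U + pairNumber (H.induce (↑U)ᶜ).connectedComponentMk < n := by
  rcases lt_or_ge (Fintype.card V) (2 * n) with hV | hV
  · have hle := pairNumber_le_card_div_two (H.induce (↑(∅ : Finset V))ᶜ).connectedComponentMk
    have hcard := set_fintype_card_le_univ ((↑(∅ : Finset V))ᶜ : Set V)
    exact ⟨∅, by rw [card_empty]; omega⟩
  obtain ⟨k, hk⟩ := Nat.exists_eq_add_of_le hV
  have hJcard : Fintype.card (V ⊕ Fin k) = 2 * (n + k) := by
    rw [Fintype.card_sum, Fintype.card_fin]; omega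
  obtain ⟨u, hu⟩ := exists_two_mul_card_add_pairNumber_lt (G := joinTop H (Fin k)) fun M hM =>
    h (stripe_isContained_of_joinTop
      (stripe_isContained_of_isPerfectMatching hM (by simp [hJcard])))
  have hright : u.toRight = univ := by
    by_contra hne
    obtain ⟨j, hj⟩ : ∃ j, j ∉ u.toRight := by simpa [eq_univ_iff_forall] using hne
    have := card_div_two_le_of_inr_notMem (H := H) (fun h => hj (mem_toRight.2 h))
    omega
  have hcard := u.card_toLeft_add_card_toRight
  have hle : pairNumber (H.induce (↑u.toLeft)ᶜ).connectedComponentMk ≤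
      pairNumber ((joinTop H (Fin k)).induce (↑u)ᶜ).connectedComponentMk := by
    let f : ((↑u.toLeft)ᶜ : Set V) ↪ ((↑u)ᶜ : Set (V ⊕ Fin k)) :=
      Function.Embedding.subtypeMap .inl fun v hv hvu => hv (mem_coe.2 (mem_toLeft.2 hvu))
    let φ : H.induce (↑u.toLeft)ᶜ →g (joinTop H (Fin k)).induce (↑u)ᶜ :=
      ⟨f, fun {x y} hxy => joinTop_adj_inl.2 hxy⟩
    exact pairNumber_le_of_refines f fun x y hxy =>
      ConnectedComponent.sound ((ConnectedComponent.exact hxy).map φ)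
  rw [hright, card_univ, Fintype.card_fin] at hcard
  exact ⟨u.toLeft, by omega⟩

/-! ### Partitions with few disjoint pairs -/

section Classes

variable {L : Type*} {p : V → L} {b : ℕ} {v w : V}

/-- The number of other vertices in the class of `v`, i.e. the degree of `v` in the disjoint union
of the complete graphs on the classes of `p`. -/
noncomputable def classDegree (p : V → L) (v : V) : ℕ :=
  #{w | w ≠ v ∧ p w = p v}

/-- The vertices in classes of more than `b + 1` elements; if `pairNumber p ≤ b`, then they form at
most one class. -/
noncomputable def dominantClass (p : V → L) (b : ℕ) : Finset V :=
  {v | b < classDegree p v}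

/-- The number of vertices by which the dominant class exceeds `b + 1`, or `0` if there is no
dominant class. -/
noncomputable def excess (p : V → L) (b : ℕ) : ℕ :=
  #(dominantClass p b) - (b + 1)

theorem mem_dominantClass : v ∈ dominantClass p b ↔ b < classDegree p v := by
  simp [dominantClass]

theorem card_class_eq (p : V → L) (v : V) : #{w | p w = p v} = classDegree p v + 1 := by
  have herase : ({w | w ≠ v ∧ p w = p v} : Finset V) = ({w | p w = p v} : Finset V).erase v := by
    ext w
    simp
  rw [classDegree, herase, card_erase_add_one (by simp)]

theorem classDegree_congr (h : p v = p w) : classDegree p v = classDegree p w := by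
  have := card_class_eq p v
  rw [h, card_class_eq] at this
  omega

theorem half_class_le_pairNumber (p : V → L) (v : V) :
    (classDegree p v + 1) / 2 ≤ pairNumber p := by
  rw [pairNumber_eq_sum, ← card_class_eq]
  exact single_le_sum (f := fun l => #{w | p w = l} / 2) (fun _ _ => Nat.zero_le _)
    (mem_image_of_mem p (mem_univ v))

theorem half_class_add_half_class_le_pairNumber (h : p v ≠ p w) :
    (classDegree p v + 1) / 2 + (classDegree p w + 1) / 2 ≤ pairNumber p := by
  rw [pairNumber_eq_sum, ← card_class_eq, ← card_class_eq,
    ← sum_pair (f := fun l => #{w | p w = l} / 2) h]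
  exact sum_le_sum_of_subset (insert_subset (mem_image_of_mem p (mem_univ v))
    (singleton_subset_iff.2 (mem_image_of_mem p (mem_univ w))))

theorem eq_of_mem_dominantClass (hb : pairNumber p ≤ b) (hv : v ∈ dominantClass p b)
    (hw : w ∈ dominantClass p b) : p w = p v := by
  rw [mem_dominantClass] at hv hw
  by_contra h
  have := half_class_add_half_class_le_pairNumber h
  omega

theorem classDegree_eq_of_mem_dominantClass (hb : pairNumber p ≤ b)
    (hv : v ∈ dominantClass p b) : classDegree p v = b + excess p b := by
  have hclass : dominantClass p b = ({w | p w = p v} : Finset V) := by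
    ext w
    rw [mem_filter, and_iff_right (mem_univ w)]
    refine ⟨eq_of_mem_dominantClass hb hv, fun h => ?_⟩
    rwa [mem_dominantClass, classDegree_congr h, ← mem_dominantClass]
  rw [mem_dominantClass] at hv
  rw [excess, hclass, card_class_eq]
  omega

theorem classDegree_add_excess_le_of_notMem_dominantClass (hb : pairNumber p ≤ b)
    (hv : v ∉ dominantClass p b) : classDegree p v + excess p b ≤ b := by
  have hvb := not_lt.1 (mem_dominantClass.not.1 hv)
  rcases (dominantClass p b).eq_empty_or_nonempty with h | ⟨w, hw⟩
  · simpa [excess, h] using hvb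
  · have hne : p w ≠ p v := fun h => by
      rw [mem_dominantClass, classDegree_congr h, ← mem_dominantClass] at hw
      exact hv hw
    have hhalf := half_class_add_half_class_le_pairNumber hne
    rw [classDegree_eq_of_mem_dominantClass hb hw] at hhalf
    omega

theorem excess_le (hb : pairNumber p ≤ b) : excess p b ≤ b := by
  rcases (dominantClass p b).eq_empty_or_nonempty with h | ⟨w, hw⟩
  · simp [excess, h]
  · have := half_class_le_pairNumber p w
    rw [classDegree_eq_of_mem_dominantClass hb hw] at this
    omega

theorem card_dominantClass_le (hb : pairNumber p ≤ b) : #(dominantClass p b) ≤ 2 * b + 1 := by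
  have := excess_le hb
  rw [excess] at this
  omega

theorem excess_mul_card_dominantClass (p : V → L) (b : ℕ) :
    excess p b * #(dominantClass p b) = excess p b * (excess p b + b + 1) := by
  rcases Nat.eq_zero_or_pos (excess p b) with h | h
  · rw [h, zero_mul, zero_mul]
  · congr 1
    rw [excess] at h ⊢
    omega

theorem even_of_forall_classDegree_eq (hb : pairNumber p ≤ b) (hdeg : ∀ v, classDegree p v = b)
    (hb0 : 0 < b) (hV : b + 1 < Fintype.card V) : Even b ∧ Fintype.card V = 2 * (b + 1) := by
  have hclass : ∀ l ∈ univ.image p, #{v | p v = l} = b + 1 := by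
    intro l hl
    obtain ⟨v, -, rfl⟩ := mem_image.1 hl
    rw [card_class_eq, hdeg]
  have hcard : Fintype.card V = #(univ.image p) * (b + 1) := by
    rw [← card_univ, card_eq_sum_card_fiberwise (f := p) (t := univ.image p) (by simp),
      sum_congr rfl hclass, sum_const, smul_eq_mul]
  have hpairs : #(univ.image p) * ((b + 1) / 2) ≤ b := by
    rwa [pairNumber_eq_sum, sum_congr rfl fun l hl => by rw [hclass l hl], sum_const,
      smul_eq_mul] at hb
  rw [hcard] at hV ⊢
  generalize #(univ.image p) = m at *
  have htwo : 2 ≤ m := by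
    by_contra! h
    interval_cases m <;> omega
  have heven : Even b := by
    by_contra hodd
    have := Nat.mul_le_mul_right ((b + 1) / 2) htwo
    grind
  obtain ⟨a, rfl⟩ := heven
  have hm : m = 2 := by
    by_contra hne
    have := Nat.mul_le_mul_right ((a + a + 1) / 2) (show 3 ≤ m by omega)
    omega
  exact ⟨⟨a, rfl⟩, by rw [hm]⟩

end Classes

theorem card_lt_of_clique_cover [Fintype ι] (D : ι → Finset V) (b : ι → ℕ) (M : ℕ)
    (hD : ∀ i, #(D i) ≤ 2 * b i + 1) (hM : ∀ i, b i ≤ M)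
    (hcov : ∀ v w, v ≠ w → ∃ i, v ∈ D i ∧ w ∈ D i) : Fintype.card V < M + 2 + ∑ i, b i := by
  have hsub : (univ : Finset V).offDiag ⊆ univ.biUnion fun i => (D i).offDiag := by
    rintro ⟨v, w⟩ hvw
    obtain ⟨i, hv, hw⟩ := hcov v w (mem_offDiag.1 hvw).2.2
    exact mem_biUnion.2 ⟨i, mem_univ _, mem_offDiag.2 ⟨hv, hw, (mem_offDiag.1 hvw).2.2⟩⟩
  have hpairs : Fintype.card V * (Fintype.card V - 1) ≤ (2 * M + 1) * (2 * ∑ i, b i) := by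
    calc Fintype.card V * (Fintype.card V - 1)
        = #(univ : Finset V).offDiag := by rw [offDiag_card, card_univ, Nat.mul_sub_one]
      _ ≤ ∑ i, #(D i).offDiag := (card_le_card hsub).trans card_biUnion_le
      _ ≤ ∑ i, (2 * M + 1) * (2 * b i) := by
          refine sum_le_sum fun i _ => ?_
          rw [offDiag_card, ← Nat.mul_sub_one]
          have := hD i
          have := hM i
          exact Nat.mul_le_mul (by omega) (by omega)
      _ = (2 * M + 1) * (2 * ∑ i, b i) := by rw [← mul_sum, ← mul_sum]
  by_contra! hN
  generalize ∑ i, b i = B at *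
  have hle : (M + 2 + B) * (M + 1 + B) ≤ (2 * M + 1) * (2 * B) :=
    (Nat.mul_le_mul hN (by omega)).trans hpairs
  zify at hle
  nlinarith [sq_nonneg ((M : ℤ) - B)]

section Partitions

variable [Fintype ι] {L : ι → Type*} {p : ∀ i, V → L i} {b : ι → ℕ} {S M : ℕ}

theorem card_lt_of_partitions (hb : ∀ i, pairNumber (p i) ≤ b i) (hM : ∀ i, b i ≤ M)
    (hdeg : ∀ v, Fintype.card V ≤ S + 1 + ∑ i, classDegree (p i) v)
    (hV : M + 2 + ∑ i, b i ≤ Fintype.card V) : Fintype.card V < S + 2 + ∑ i, b i := by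
  obtain ⟨v, w, hvw⟩ : ∃ v w, ∀ i, v ∈ dominantClass (p i) (b i) →
      w ∉ dominantClass (p i) (b i) := by
    by_contra! hcov
    refine absurd (card_lt_of_clique_cover (fun i => dominantClass (p i) (b i)) b M
      (fun i => card_dominantClass_le (hb i)) hM fun v w _ => hcov v w) (not_lt.2 hV)
  have hpair (i : ι) : classDegree (p i) v + classDegree (p i) w ≤ 2 * b i := by
    have := excess_le (hb i)
    by_cases hv : v ∈ dominantClass (p i) (b i)
    · have := classDegree_eq_of_mem_dominantClass (hb i) hv
      have := classDegree_add_excess_le_of_notMem_dominantClass (hb i) (hvw i hv)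
      omega
    · have := classDegree_add_excess_le_of_notMem_dominantClass (hb i) hv
      by_cases hw : w ∈ dominantClass (p i) (b i)
      · have := classDegree_eq_of_mem_dominantClass (hb i) hw
        omega
      · have := classDegree_add_excess_le_of_notMem_dominantClass (hb i) hw
        omega
  have hsum := sum_le_sum fun i (_ : i ∈ univ) => hpair i
  rw [sum_add_distrib, ← mul_sum] at hsum
  have := hdeg v
  have := hdeg w
  omega

/-- The excess, negated at the vertices outside the dominant class. -/
noncomputable def signedExcess {L : Type*} (p : V → L) (b : ℕ) (v : V) : ℤ :=
  if v ∈ dominantClass p b then excess p b else -excess p b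

theorem classDegree_le_add_signedExcess {L : Type*} {p : V → L} {b : ℕ} (hb : pairNumber p ≤ b)
    (v : V) : (classDegree p v : ℤ) ≤ b + signedExcess p b v := by
  rw [signedExcess]
  split_ifs with h
  · rw [classDegree_eq_of_mem_dominantClass hb h, Nat.cast_add]
  · have := classDegree_add_excess_le_of_notMem_dominantClass hb h
    omega

theorem sum_signedExcess {L : Type*} (p : V → L) (b : ℕ) :
    ∑ v, signedExcess p b v =
      excess p b * (2 * (excess p b + b + 1) - Fintype.card V) := by
  have hsplit (v : V) : signedExcess p b v =
      (if v ∈ dominantClass p b then 2 * (excess p b : ℤ) else 0) - excess p b := by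
    rw [signedExcess]
    split_ifs <;> ring
  have hmul : (excess p b : ℤ) * #(dominantClass p b) = excess p b * (excess p b + b + 1) := by
    exact_mod_cast excess_mul_card_dominantClass p b
  simp only [hsplit, sum_sub_distrib, sum_ite_mem, univ_inter, sum_const, card_univ, nsmul_eq_mul]
  linear_combination 2 * hmul

theorem sum_signedExcess_nonneg (hb : ∀ i, pairNumber (p i) ≤ b i) {v : V}
    (hdeg : ∑ i, b i ≤ ∑ i, classDegree (p i) v) : 0 ≤ ∑ i, signedExcess (p i) (b i) v := by
  have hle := sum_le_sum fun i (_ : i ∈ univ) => classDegree_le_add_signedExcess (hb i) v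
  rw [sum_add_distrib] at hle
  zify at hdeg
  linarith

theorem two_mul_excess_le_sum_of_notMem {v : V} {i : ι}
    (hv : 0 ≤ ∑ j, signedExcess (p j) (b j) v) (hi : v ∉ dominantClass (p i) (b i)) :
    2 * excess (p i) (b i) ≤ ∑ j, excess (p j) (b j) := by
  have hle : ∑ j ∈ univ.erase i, signedExcess (p j) (b j) v ≤
      ∑ j ∈ univ.erase i, (excess (p j) (b j) : ℤ) := by
    refine sum_le_sum fun j _ => ?_
    rw [signedExcess]
    split_ifs <;> omega
  rw [← add_sum_erase univ _ (mem_univ i), signedExcess, if_neg hi] at hv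
  rw [← add_sum_erase univ _ (mem_univ i)]
  zify
  linarith

-- If the coefficient of `e i₀` is at most `P`, where `0 ≤ P`, then those of the other `e i` are at
-- most `-(P + 1)`, and `e i₀` is at most the sum of the other `e i`.
theorem eq_zero_of_sum_mul_nonneg (i₀ : ι) (e b : ι → ℤ) (S : ℤ) (he : ∀ i, 0 ≤ e i)
    (heb : ∀ i, e i ≤ b i) (hhalf : ∀ i, 2 * e i ≤ ∑ j, e j)
    (hS : ∀ i, i ≠ i₀ → 2 * b i + 2 ≤ S)
    (h : 0 ≤ ∑ i, e i * (2 * (e i + b i + 1) - (S + 1 + ∑ j, b j))) (i : ι) : e i = 0 := by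
  set B := ∑ j, b j
  set P := max (2 * (e i₀ + b i₀ + 1) - (S + 1 + B)) 0 with hP
  have hEsplit := add_sum_erase univ e (mem_univ i₀)
  have hi₀ := hhalf i₀
  have hother : ∀ i ∈ univ.erase i₀,
      e i * (2 * (e i + b i + 1) - (S + 1 + B)) ≤ e i * (-(P + 1)) := by
    intro i hi
    refine mul_le_mul_of_nonneg_left ?_ (he i)
    have hBsplit := add_sum_erase univ b (mem_univ i₀)
    have hle : ∑ i ∈ univ.erase i₀, e i ≤ ∑ i ∈ univ.erase i₀, b i := sum_le_sum fun i _ => heb i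
    have := hS i (ne_of_mem_erase hi)
    have := hhalf i
    have := heb i
    have := heb i₀
    have := he i₀
    rcases max_cases (2 * (e i₀ + b i₀ + 1) - (S + 1 + B)) 0 with hmax | hmax <;>
      rw [hP, hmax.1] <;> linarith
  have hneg : ∑ i, e i * (2 * (e i + b i + 1) - (S + 1 + B)) ≤ -∑ i ∈ univ.erase i₀, e i := by
    calc ∑ i, e i * (2 * (e i + b i + 1) - (S + 1 + B))
        = e i₀ * (2 * (e i₀ + b i₀ + 1) - (S + 1 + B)) +
          ∑ i ∈ univ.erase i₀, e i * (2 * (e i + b i + 1) - (S + 1 + B)) :=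
          (add_sum_erase univ _ (mem_univ i₀)).symm
      _ ≤ e i₀ * P + ∑ i ∈ univ.erase i₀, e i * (-(P + 1)) :=
          add_le_add (mul_le_mul_of_nonneg_left (le_max_left _ _) (he i₀)) (sum_le_sum hother)
      _ ≤ (∑ i ∈ univ.erase i₀, e i) * P + ∑ i ∈ univ.erase i₀, e i * (-(P + 1)) :=
          add_le_add_left (mul_le_mul_of_nonneg_right (by linarith) (le_max_right _ _)) _
      _ = -∑ i ∈ univ.erase i₀, e i := by rw [← sum_mul]; ring
  have := hhalf i
  have := he i
  linarith

theorem excess_eq_zero_of_partitions (i₀ : ι) (hb : ∀ i, pairNumber (p i) ≤ b i)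
    (hM : ∀ i, b i ≤ M) (hdeg : ∀ v, ∑ i, b i ≤ ∑ i, classDegree (p i) v)
    (hV : Fintype.card V = S + 1 + ∑ i, b i) (hMS : M + 1 ≤ S)
    (hS : ∀ i, i ≠ i₀ → 2 * b i + 2 ≤ S) (i : ι) : excess (p i) (b i) = 0 := by
  obtain ⟨v, w, hvw⟩ : ∃ v w, ∀ i, v ∈ dominantClass (p i) (b i) →
      w ∉ dominantClass (p i) (b i) := by
    by_contra! hcov
    have := card_lt_of_clique_cover (fun i => dominantClass (p i) (b i)) b M
      (fun i => card_dominantClass_le (hb i)) hM fun v w _ => hcov v w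
    omega
  have hnonneg (v : V) := sum_signedExcess_nonneg hb (hdeg v)
  have hhalf (i : ι) : 2 * excess (p i) (b i) ≤ ∑ j, excess (p j) (b j) := by
    by_cases hv : v ∈ dominantClass (p i) (b i)
    · exact two_mul_excess_le_sum_of_notMem (hnonneg w) (hvw i hv)
    · exact two_mul_excess_le_sum_of_notMem (hnonneg v) hv
  have hdouble := sum_nonneg fun v (_ : v ∈ univ) => hnonneg v
  rw [sum_comm] at hdouble
  simp only [sum_signedExcess, hV] at hdouble
  push_cast at hdouble
  exact_mod_cast eq_zero_of_sum_mul_nonneg i₀ (fun i => (excess (p i) (b i) : ℤ)) (fun i => b i) S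
    (fun i => Nat.cast_nonneg _) (fun i => by exact_mod_cast excess_le (hb i))
    (fun i => by exact_mod_cast hhalf i) (fun i hi => by exact_mod_cast hS i hi) hdouble i

theorem classDegree_eq_of_excess_eq_zero (hb : ∀ i, pairNumber (p i) ≤ b i)
    (hexc : ∀ i, excess (p i) (b i) = 0) {v : V} (hdeg : ∑ i, b i ≤ ∑ i, classDegree (p i) v)
    (i : ι) : classDegree (p i) v = b i := by
  have hle : ∀ j ∈ univ, classDegree (p j) v ≤ b j := fun j _ => by
    have := classDegree_le_add_signedExcess (hb j) v
    simpa [signedExcess, hexc j] using this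
  exact (sum_eq_sum_iff_of_le hle).1 (le_antisymm (sum_le_sum hle) hdeg) i (mem_univ i)

theorem injective_of_partitions (i₀ : ι) (hb : ∀ i, pairNumber (p i) ≤ b i) (hM : ∀ i, b i ≤ M)
    (hdeg : ∀ v, ∑ i, b i ≤ ∑ i, classDegree (p i) v)
    (hV : Fintype.card V = S + 1 + ∑ i, b i) (hSeven : Even S) (hMS : M + 1 ≤ S)
    (hS : ∀ i, i ≠ i₀ → 2 * b i + 2 ≤ S) :
    (∀ i, b i = 0) ∧ ∀ i, Function.Injective (p i) := by
  have hclass (i : ι) (v : V) : classDegree (p i) v = b i :=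
    classDegree_eq_of_excess_eq_zero hb
      (excess_eq_zero_of_partitions i₀ hb hM hdeg hV hMS hS) (hdeg v) i
  have hparity (i : ι) (hi : 0 < b i) : Even (b i) ∧ Fintype.card V = 2 * (b i + 1) := by
    have := single_le_sum (f := b) (fun _ _ => Nat.zero_le _) (mem_univ i)
    exact even_of_forall_classDegree_eq (hb i) (hclass i) hi (by omega)
  have hzero (i : ι) : b i = 0 := by
    by_contra hi
    have hodd : Odd (Fintype.card V) := by
      rw [hV]
      refine hSeven.add_one.add_even (even_sum _ fun j _ => ?_)
      rcases Nat.eq_zero_or_pos (b j) with h | h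
      · simp [h]
      · exact (hparity j h).1
    exact Nat.not_even_iff_odd.2 hodd ⟨b i + 1, by rw [(hparity i (by omega)).2, two_mul]⟩
  refine ⟨hzero, fun i v w hvw => ?_⟩
  have h := (hclass i w).trans (hzero i)
  rw [classDegree, card_eq_zero, filter_eq_empty_iff] at h
  by_contra hne
  exact h (mem_univ v) ⟨hne, hvw⟩

end Partitions

/-! ### Upper bounds -/

theorem card_le_sum_degree_add_sum_classDegree [Fintype κ] [Fintype ι] {L : ι → Type*}
    {G : κ → SimpleGraph V} {p : ∀ i, V → L i}
    (hcov : ∀ x y, x ≠ y → (∃ k, (G k).Adj x y) ∨ ∃ i, p i x = p i y) (v : V) :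
    Fintype.card V ≤ ∑ k, (G k).degree v + 1 + ∑ i, classDegree (p i) v := by
  have hsub : (univ : Finset V).erase v ⊆ (univ.biUnion fun k => (G k).neighborFinset v) ∪
      univ.biUnion fun i => {w | w ≠ v ∧ p i w = p i v} := by
    intro w hw
    have hne := ne_of_mem_erase hw
    rw [mem_union, mem_biUnion, mem_biUnion]
    rcases hcov v w hne.symm with ⟨k, hk⟩ | ⟨i, hi⟩
    · exact Or.inl ⟨k, mem_univ _, by simpa using hk⟩
    · exact Or.inr ⟨i, mem_univ _, by simp [hne, hi]⟩
  have hcard := (card_le_card hsub).trans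
    ((card_union_le _ _).trans (Nat.add_le_add card_biUnion_le card_biUnion_le))
  rw [card_erase_of_mem (mem_univ v), card_univ] at hcard
  simp only [card_neighborFinset_eq_degree] at hcard
  simp only [classDegree]
  omega

theorem card_le_sum_degree_add_one [Fintype κ] {G : κ → SimpleGraph V} (hG : ⨆ k, G k = ⊤)
    (v : V) : Fintype.card V ≤ ∑ k, (G k).degree v + 1 := by
  have hcov (x y : V) (hxy : x ≠ y) : ∃ k, (G k).Adj x y := by rwa [← iSup_adj, hG, top_adj]
  simpa using card_le_sum_degree_add_sum_classDegree (ι := Empty) (L := fun _ => Unit)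
    (p := fun _ _ => ()) (fun x y hxy => Or.inl (hcov x y hxy)) v

theorem odd_of_iSup_eq_top_of_even_sum [Fintype κ] {t : κ → ℕ} {G : κ → SimpleGraph V}
    (hG : ⨆ k, G k = ⊤) (hdeg : ∀ k v, (G k).degree v < t k)
    (hV : Fintype.card V = ∑ k, (t k - 1) + 1) (hS : Even (∑ k, (t k - 1))) (k : κ) :
    Odd (t k) := by
  by_contra hk
  have hle (v : V) (j : κ) (_ : j ∈ univ) : (G j).degree v ≤ t j - 1 :=
    Nat.le_sub_one_of_lt (hdeg j v)
  have hregular (v : V) : (G k).degree v = t k - 1 := by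
    have hcard := card_le_sum_degree_add_one hG v
    exact (sum_eq_sum_iff_of_le (hle v)).1
      (le_antisymm (sum_le_sum (hle v)) (by omega)) k (mem_univ k)
  have hoddDegree (v : V) : Odd ((G k).degree v) := by
    rw [hregular]
    exact Nat.Even.sub_odd (Nat.one_le_of_lt (hdeg k v)) (Nat.not_odd_iff_even.1 hk) odd_one
  have heven := (G k).even_card_odd_degree_vertices
  rw [filter_true_of_mem fun v _ => hoddDegree v, card_univ, hV] at heven
  exact Nat.not_even_iff_odd.2 hS.add_one heven

theorem arrows_star [Fintype κ] {t : κ → ℕ} (hV : ∑ k, (t k - 1) + 2 ≤ Fintype.card V) :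
    Arrows (⊤ : SimpleGraph V) fun k => star_S (t k) := by
  rw [arrows_top_iff]
  intro G hG
  simp only [star_isContained_iff]
  by_contra! hdeg
  obtain ⟨v⟩ : Nonempty V := Fintype.card_pos_iff.1 (by omega)
  have hcard := card_le_sum_degree_add_one hG v
  have hle : ∑ k, (G k).degree v ≤ ∑ k, (t k - 1) :=
    sum_le_sum fun k _ => Nat.le_sub_one_of_lt (hdeg k v)
  omega

theorem arrows_star_of_even_sum [Fintype κ] {t : κ → ℕ}
    (hV : Fintype.card V = ∑ k, (t k - 1) + 1) (hS : Even (∑ k, (t k - 1)))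
    (ht : ∃ k, Even (t k)) : Arrows (⊤ : SimpleGraph V) fun k => star_S (t k) := by
  rw [arrows_top_iff]
  intro G hG
  simp only [star_isContained_iff]
  by_contra! hdeg
  obtain ⟨k, hk⟩ := ht
  exact Nat.not_odd_iff_even.2 hk (odd_of_iSup_eq_top_of_even_sum hG hdeg hV hS k)

theorem exists_partitions_of_not_arrows [Fintype ι] {t : κ → ℕ} {n : ι → ℕ}
    (h : ¬ Arrows (⊤ : SimpleGraph V)
      (Sum.elim (fun k => star_S (t k)) (fun i => stripe (n i)))) :
    ∃ (X : Finset V) (G : κ → SimpleGraph X) (L : ι → Type) (p : ∀ i, X → L i) (b : ι → ℕ),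
      (∀ k v, (G k).degree v < t k) ∧
      (∀ x y, x ≠ y → (∃ k, (G k).Adj x y) ∨ ∃ i, p i x = p i y) ∧
      (∀ i, pairNumber (p i) ≤ b i) ∧ (∀ i, b i < n i) ∧
      Fintype.card V + ∑ i, b i ≤ Fintype.card X + ∑ i, (n i - 1) := by
  rw [arrows_top_iff] at h
  simp only [not_forall, not_exists, exists_prop] at h
  obtain ⟨H, hH, hfree⟩ := h
  choose U hU using fun i => exists_card_add_pairNumber_lt (hfree (Sum.inr i))
  let X : Finset V := (univ.biUnion U)ᶜ
  have hX (x : X) (i : ι) : x.1 ∉ U i := fun hx =>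
    mem_compl.1 x.2 (mem_biUnion.2 ⟨i, mem_univ i, hx⟩)
  let f (i : ι) : X ↪ ((↑(U i))ᶜ : Set V) := ⟨fun x => ⟨x.1, hX x i⟩, fun x y hxy =>
    Subtype.ext (congrArg (fun z => z.1) hxy)⟩
  refine ⟨X, fun k => (H (Sum.inl k)).comap Subtype.val, fun i => _,
    fun i x => ((H (Sum.inr i)).induce (↑(U i))ᶜ).connectedComponentMk (f i x),
    fun i => n i - 1 - #(U i), fun k v => ?_, fun x y hxy => ?_, fun i => ?_, fun i => ?_, ?_⟩
  · by_contra! hv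
    exact hfree (Sum.inl k) ((star_isContained_iff.2 ⟨v, hv⟩).trans
      (Embedding.comap (Function.Embedding.subtype _) _).isContained)
  · have hadj : (⨆ i, H i).Adj x.1 y.1 := by rw [hH]; exact fun h => hxy (Subtype.ext h)
    obtain ⟨k | i, hxy⟩ := iSup_adj.1 hadj
    · exact Or.inl ⟨k, hxy⟩
    · exact Or.inr ⟨i, ConnectedComponent.sound (Adj.reachable hxy)⟩
  · exact (pairNumber_le_of_refines (f i) fun _ _ => id).trans (by have := hU i; dsimp only; omega)
  · have := hU i
    dsimp only
    omega
  · have hle : #(univ.biUnion U) ≤ ∑ i, #(U i) := card_biUnion_le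
    have hcompl : #X + #(univ.biUnion U) = Fintype.card V := card_compl_add_card _
    have hsum : ∑ i, (n i - 1 - #(U i)) + ∑ i, #(U i) = ∑ i, (n i - 1) := by
      rw [← sum_add_distrib]
      exact sum_congr rfl fun i _ => Nat.sub_add_cancel (by have := hU i; omega)
    rw [Fintype.card_coe]
    dsimp only
    omega

theorem card_le_sum_add_sum_classDegree [Fintype κ] [Fintype ι] {L : ι → Type*} {t : κ → ℕ}
    {G : κ → SimpleGraph V} {p : ∀ i, V → L i} (hG : ∀ k v, (G k).degree v < t k)
    (hcov : ∀ x y, x ≠ y → (∃ k, (G k).Adj x y) ∨ ∃ i, p i x = p i y) (v : V) :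
    Fintype.card V ≤ ∑ k, (t k - 1) + 1 + ∑ i, classDegree (p i) v := by
  have hcard := card_le_sum_degree_add_sum_classDegree hcov v
  have hle : ∑ k, (G k).degree v ≤ ∑ k, (t k - 1) :=
    sum_le_sum fun k _ => Nat.le_sub_one_of_lt (hG k v)
  omega

theorem arrows_star_stripe [Fintype κ] [Fintype ι] {t : κ → ℕ} {n : ι → ℕ} {i₀ : ι}
    (hi₀ : ∀ i, n i ≤ n i₀) (hn : n i₀ + ∑ i, (n i - 1) + 1 ≤ Fintype.card V)
    (hS : ∑ k, (t k - 1) + ∑ i, (n i - 1) + 2 ≤ Fintype.card V) :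
    Arrows (⊤ : SimpleGraph V)
      (Sum.elim (fun k => star_S (t k)) (fun i => stripe (n i))) := by
  by_contra h
  obtain ⟨X, G, L, p, b, hG, hcov, hp, hbn, hX⟩ := exists_partitions_of_not_arrows h
  have := hbn i₀
  have hlt := card_lt_of_partitions (M := n i₀ - 1) hp
    (fun i => Nat.le_sub_one_of_lt ((hbn i).trans_le (hi₀ i)))
    (card_le_sum_add_sum_classDegree hG hcov) (by omega)
  omega

theorem arrows_star_stripe_of_even_sum [Fintype κ] [Fintype ι] {t : κ → ℕ} {n : ι → ℕ} {i₀ : ι}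
    (hi₀ : ∀ i, n i ≤ n i₀) (hn : n i₀ + ∑ i, (n i - 1) + 1 ≤ Fintype.card V)
    (hS : ∑ k, (t k - 1) + ∑ i, (n i - 1) + 1 ≤ Fintype.card V)
    (hSeven : Even (∑ k, (t k - 1))) (ht : ∃ k, Even (t k)) (hni₀ : n i₀ ≤ ∑ k, (t k - 1))
    (hni : ∀ i ≠ i₀, 2 * n i ≤ ∑ k, (t k - 1)) :
    Arrows (⊤ : SimpleGraph V)
      (Sum.elim (fun k => star_S (t k)) (fun i => stripe (n i))) := by
  by_contra h
  obtain ⟨X, G, L, p, b, hG, hcov, hp, hbn, hX⟩ := exists_partitions_of_not_arrows h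
  have hbM (i : ι) : b i ≤ n i₀ - 1 := Nat.le_sub_one_of_lt ((hbn i).trans_le (hi₀ i))
  have hdeg := card_le_sum_add_sum_classDegree hG hcov
  have := hbn i₀
  have hlt := card_lt_of_partitions hp hbM hdeg (by omega)
  obtain ⟨hb0, hinj⟩ := injective_of_partitions i₀ hp hbM (fun v => by have := hdeg v; omega)
    (by omega) hSeven (by omega) (fun i hi => by have := hni i hi; have := hbn i; omega)
  have hGtop : ⨆ k, G k = ⊤ := by
    refine eq_top_iff.2 fun x y hxy => iSup_adj.2 ?_
    exact (hcov x y hxy).resolve_right fun ⟨i, hi⟩ => hxy (hinj i hi)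
  have hcard : Fintype.card X = ∑ k, (t k - 1) + 1 := by
    have : ∑ i, b i = 0 := sum_eq_zero fun i _ => hb0 i
    omega
  obtain ⟨k, hk⟩ := ht
  exact Nat.not_odd_iff_even.2 hk (odd_of_iSup_eq_top_of_even_sum hGtop hG hcard hSeven k)

/-! ### The Ramsey number of stars -/

theorem exists_iSup_eq_of_card_le_sum {K : Type*} [Fintype K] [Fintype κ] {q : ℕ}
    {F : K → SimpleGraph V} (hF : ∀ k v, (F k).degree v ≤ q) (u : κ → ℕ)
    (hu : Fintype.card K ≤ ∑ i, u i) :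
    ∃ G : κ → SimpleGraph V, ⨆ i, G i = ⨆ k, F k ∧ ∀ i v, (G i).degree v ≤ q * u i := by
  obtain ⟨g⟩ : Nonempty (K ↪ Σ i, Fin (u i)) :=
    Function.Embedding.nonempty_of_card_le (by simpa using hu)
  refine ⟨fun i => ⨆ (k) (_ : (g k).1 = i), F k, ?_, fun i v => ?_⟩
  · rw [iSup_comm]
    simp only [iSup_iSup_eq_right]
  have hfibre : #{k | (g k).1 = i} ≤ u i := by
    rw [← Fintype.card_subtype, ← Fintype.card_fin (u i)]
    exact Fintype.card_le_of_embedding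
      ((g.subtypeMap fun _ => id).trans (Equiv.sigmaSubtype i).toEmbedding)
  have hsub : (⨆ (k) (_ : (g k).1 = i), F k).neighborFinset v ⊆
      ({k | (g k).1 = i} : Finset K).biUnion fun k => (F k).neighborFinset v := by
    intro w hw
    simpa using hw
  rw [← card_neighborFinset_eq_degree, mul_comm]
  calc #((⨆ (k) (_ : (g k).1 = i), F k).neighborFinset v)
      ≤ ∑ k with (g k).1 = i, #((F k).neighborFinset v) := (card_le_card hsub).trans card_biUnion_le
    _ ≤ #{k | (g k).1 = i} * q := sum_le_card_nsmul _ _ _ fun k _ => by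
        rw [card_neighborFinset_eq_degree]
        exact hF k v
    _ ≤ u i * q := Nat.mul_le_mul_right _ hfibre

theorem not_arrows_star_of_factors {K : Type*} [Fintype K] [Fintype κ] {q : ℕ} {t u : κ → ℕ}
    {F : K → SimpleGraph V} (hFtop : ⨆ k, F k = ⊤) (hF : ∀ k v, (F k).degree v ≤ q)
    (hu : Fintype.card K ≤ ∑ i, u i) (ht : ∀ i, q * u i < t i) :
    ¬ Arrows (⊤ : SimpleGraph V) fun i => star_S (t i) := by
  obtain ⟨G, hG, hdeg⟩ := exists_iSup_eq_of_card_le_sum hF u hu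
  intro h
  obtain ⟨i, hi⟩ := arrows_top_iff.1 h G (hG.trans hFtop)
  obtain ⟨v, hv⟩ := star_isContained_iff.1 hi
  exact absurd (hv.trans (hdeg i v)) (not_le.2 (ht i))

/-- The factor of colour `k` in the round-robin factorization of the complete graph on `A ∪ {∞}`:
a pair `{x, y}` in `A` has colour `x + y`, and a pair `{x, ∞}` has colour `x + x`. -/
def roundRobin {A : Type*} [AddCommGroup A] (k : A) : SimpleGraph (Option A) :=
  fromRel fun x y => x.getD (y.getD 0) + y.getD (x.getD 0) = k

theorem roundRobin_adj {A : Type*} [AddCommGroup A] {k : A} {x y : Option A} :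
    (roundRobin k).Adj x y ↔ x ≠ y ∧ x.getD (y.getD 0) + y.getD (x.getD 0) = k := by
  rw [roundRobin, fromRel_adj, add_comm (y.getD _), or_self]

theorem iSup_roundRobin {A : Type*} [AddCommGroup A] :
    ⨆ k : A, roundRobin k = ⊤ := by
  refine eq_top_iff.2 fun x y hxy => iSup_adj.2 ⟨_, roundRobin_adj.2 ⟨hxy, rfl⟩⟩

theorem degree_roundRobin_le {A : Type} [AddCommGroup A] [Fintype A]
    (hA : Function.Injective fun a : A => a + a) (k : A) (x : Option A) :
    (roundRobin k).degree x ≤ 1 := by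
  rw [← card_neighborFinset_eq_degree, card_le_one]
  simp only [mem_neighborFinset, roundRobin_adj]
  rintro y ⟨hxy, rfl⟩ z ⟨hxz, hyz⟩
  rcases x with _ | x <;> rcases y with _ | y <;> rcases z with _ | z <;>
    simp_all [hA.eq_iff]

theorem not_arrows_star_of_odd [Fintype κ] {t : κ → ℕ} {m : ℕ} (ht : ∀ k, 0 < t k) (hm : Odd m)
    (hS : m ≤ ∑ k, (t k - 1)) (hV : Fintype.card V ≤ m + 1) :
    ¬ Arrows (⊤ : SimpleGraph V) fun k => star_S (t k) := by
  have : NeZero m := ⟨hm.pos.ne'⟩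
  have hdouble : Function.Injective fun a : ZMod m => a + a := by
    have htwo : IsUnit (2 : ZMod m) := by
      exact_mod_cast (ZMod.isUnit_iff_coprime 2 m).2 (Nat.coprime_two_left.2 hm)
    intro a b hab
    exact htwo.mul_left_cancel (by simpa only [two_mul] using hab)
  refine fun h => not_arrows_star_of_factors (u := fun k => t k - 1) iSup_roundRobin
    (degree_roundRobin_le hdouble) (by rwa [ZMod.card])
    (fun k => by rw [one_mul]; exact Nat.sub_lt (ht k) one_pos)
    (h.of_card_le (W := Option (ZMod m)) (by rwa [Fintype.card_option, ZMod.card]))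

theorem degree_circulantGraph_singleton_le {A : Type} [AddGroup A] [Fintype A] (a v : A) :
    (circulantGraph {a}).degree v ≤ 2 := by
  rw [← card_neighborFinset_eq_degree]
  refine (card_le_card (t := {a + v, -a + v}) fun w hw => ?_).trans card_le_two
  rw [mem_neighborFinset, circulantGraph, fromRel_adj, Set.mem_singleton_iff] at hw
  rw [mem_insert, mem_singleton]
  rcases hw.2 with rfl | h
  · exact Or.inr (by simp)
  · exact Or.inl (by rw [← h]; simp)

theorem iSup_circulantGraph_eq_top (m : ℕ) :
    ⨆ k : Fin m, circulantGraph {((k + 1 : ℕ) : ZMod (2 * m + 1))} = ⊤ := by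
  have hsmall (a : ZMod (2 * m + 1)) (ha : a ≠ 0) (ham : a.val ≤ m) :
      ∃ k : Fin m, a = ((k + 1 : ℕ) : ZMod (2 * m + 1)) := by
    have hpos : a.val ≠ 0 := (ZMod.val_eq_zero a).not.2 ha
    refine ⟨⟨a.val - 1, by omega⟩, ?_⟩
    rw [Fin.val_mk, Nat.sub_add_cancel (by omega), ZMod.natCast_zmod_val]
  refine eq_top_iff.2 fun x y hxy => iSup_adj.2 ?_
  simp only [circulantGraph, fromRel_adj, Set.mem_singleton_iff]
  rcases le_or_gt (x - y).val m with h | h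
  · obtain ⟨k, hk⟩ := hsmall (x - y) (sub_ne_zero.2 hxy) h
    exact ⟨k, hxy, Or.inl hk⟩
  · have hval : (y - x).val ≤ m := by
      rw [← neg_sub, ZMod.neg_val, if_neg (sub_ne_zero.2 hxy)]
      omega
    obtain ⟨k, hk⟩ := hsmall (y - x) (sub_ne_zero.2 hxy.symm) hval
    exact ⟨k, hxy, Or.inr hk⟩

theorem not_arrows_star_of_forall_odd [Fintype κ] {t : κ → ℕ} (ht : ∀ k, Odd (t k))
    (hV : Fintype.card V ≤ ∑ k, (t k - 1) + 1) :
    ¬ Arrows (⊤ : SimpleGraph V) fun k => star_S (t k) := by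
  have hhalf (k : κ) : 2 * ((t k - 1) / 2) = t k - 1 :=
    Nat.two_mul_div_two_of_even (Nat.Odd.sub_odd (ht k) odd_one)
  obtain ⟨m, hm⟩ : ∃ m, ∑ k, (t k - 1) / 2 = m := ⟨_, rfl⟩
  have hsum : ∑ k, (t k - 1) = 2 * m := by
    rw [← hm, mul_sum]
    exact sum_congr rfl fun k _ => (hhalf k).symm
  rw [hsum, ← ZMod.card (2 * m + 1)] at hV
  refine fun h => not_arrows_star_of_factors (u := fun k => (t k - 1) / 2)
    (iSup_circulantGraph_eq_top m) (fun k v => by convert degree_circulantGraph_singleton_le _ v)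
    (by rw [Fintype.card_fin, hm])
    (fun k => by rw [hhalf]; exact Nat.sub_lt (ht k).pos one_pos) (h.of_card_le hV)

theorem not_arrows_star [Fintype κ] {t : κ → ℕ} (ht : ∀ k, 0 < t k)
    (h : ¬ (Even (∑ k, (t k - 1)) ∧ ∃ k, Even (t k)))
    (hV : Fintype.card V ≤ ∑ k, (t k - 1) + 1) :
    ¬ Arrows (⊤ : SimpleGraph V) fun k => star_S (t k) := by
  rcases Nat.even_or_odd (∑ k, (t k - 1)) with hS | hS
  · exact not_arrows_star_of_forall_odd
      (fun k => Nat.not_even_iff_odd.1 fun hk => h ⟨hS, k, hk⟩) hV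
  · exact not_arrows_star_of_odd ht hS le_rfl hV

theorem not_arrows_star_of_even [Fintype κ] {t : κ → ℕ} (ht : ∀ k, 0 < t k)
    (hS : Even (∑ k, (t k - 1))) (hteven : ∃ k, Even (t k))
    (hV : Fintype.card V ≤ ∑ k, (t k - 1)) :
    ¬ Arrows (⊤ : SimpleGraph V) fun k => star_S (t k) := by
  obtain ⟨k, m, hk⟩ := hteven
  have hpos := ht k
  have hle := single_le_sum (f := fun k => t k - 1) (fun _ _ => Nat.zero_le _) (mem_univ k)
  exact not_arrows_star_of_odd ht (Nat.Even.sub_odd (m := ∑ k, (t k - 1)) (by omega) hS odd_one)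
    (Nat.sub_le _ _) (by omega)

theorem ramseyNumber_star [Fintype κ] {t : κ → ℕ} (ht : ∀ k, 0 < t k) :
    ramseyNumber (fun k => star_S (t k)) =
      if Even (∑ k, (t k - 1)) ∧ ∃ k, Even (t k) then ∑ k, (t k - 1) + 1
      else ∑ k, (t k - 1) + 2 := by
  split_ifs with h
  · exact ramseyNumber_eq_succ (arrows_star_of_even_sum (by simp) h.1 h.2)
      (not_arrows_star_of_even ht h.1 h.2 (by simp))
  · exact ramseyNumber_eq_succ (arrows_star (by simp)) (not_arrows_star ht h (by simp))

end Fintype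

/-! ### Lower bounds and the Ramsey number -/

theorem degree_sum_inl {G : SimpleGraph V} {H : SimpleGraph W} {v : V}
    [Fintype (G.neighborSet v)] {_ : Fintype ((G ⊕g H).neighborSet (Sum.inl v))} :
    (G ⊕g H).degree (Sum.inl v) = G.degree v := by
  rw [← card_neighborSet_eq_degree, ← card_neighborSet_eq_degree, ← Nat.card_eq_fintype_card,
    ← Nat.card_eq_fintype_card, neighborSet_sum_inl, Nat.card_image_of_injective Sum.inl_injective]

theorem degree_sum_inr {G : SimpleGraph V} {H : SimpleGraph W} {w : W}
    [Fintype (H.neighborSet w)] {_ : Fintype ((G ⊕g H).neighborSet (Sum.inr w))} :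
    (G ⊕g H).degree (Sum.inr w) = H.degree w := by
  rw [← card_neighborSet_eq_degree, ← card_neighborSet_eq_degree, ← Nat.card_eq_fintype_card,
    ← Nat.card_eq_fintype_card, neighborSet_sum_inr, Nat.card_image_of_injective Sum.inr_injective]

/-- The graph of colour `j` when the cliques on the sets `A i` in the colours `i` are extended by
`x i` new vertices for each colour `i`, all of whose edges get the colour `i`. An edge between new
vertices of different colours gets both colours, as the colour classes need only cover. -/
def stripeExtension (A : ι → Finset W) (x : ι → ℕ) (j : ι) : SimpleGraph (W ⊕ Σ i, Fin (x i)) :=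
  fromRel fun u v => (∃ a ∈ A j, ∃ b ∈ A j, u = Sum.inl a ∧ v = Sum.inl b) ∨
    ∃ k, u = Sum.inr ⟨j, k⟩

theorem stripeExtension_adj_inr {A : ι → Finset W} {x : ι → ℕ} (z : Σ i, Fin (x i))
    {u : W ⊕ Σ i, Fin (x i)} (hu : Sum.inr z ≠ u) :
    (stripeExtension A x z.1).Adj (Sum.inr z) u :=
  (fromRel_adj ..).2 ⟨hu, Or.inl (Or.inr ⟨z.2, rfl⟩)⟩

/-- The factor of colour `k` in the factorization of the complete bipartite graph between two copies
of `B` in which `x` and `y` are joined in colour `x + y`; a further vertex `none` is isolated. -/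
def crossFactor {B : Type*} [Add B] (k : B) : SimpleGraph (Option (B ⊕ B)) :=
  fromRel fun u v => ∃ x y, x + y = k ∧ u = some (Sum.inl x) ∧ v = some (Sum.inr y)

theorem crossFactor_adj {B : Type*} [Add B] {k : B} {u v : Option (B ⊕ B)} :
    (crossFactor k).Adj u v ↔
      ∃ x y, x + y = k ∧ (u = some (Sum.inl x) ∧ v = some (Sum.inr y) ∨
        v = some (Sum.inl x) ∧ u = some (Sum.inr y)) := by
  rw [crossFactor, fromRel_adj]
  constructor
  · rintro ⟨-, ⟨x, y, h, hu⟩ | ⟨x, y, h, hu⟩⟩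
    · exact ⟨x, y, h, Or.inl hu⟩
    · exact ⟨x, y, h, Or.inr hu⟩
  · rintro ⟨x, y, h, ⟨rfl, rfl⟩ | ⟨rfl, rfl⟩⟩
    · exact ⟨by simp, Or.inl ⟨x, y, h, rfl, rfl⟩⟩
    · exact ⟨by simp, Or.inr ⟨x, y, h, rfl, rfl⟩⟩

section Fintype

variable [Fintype V] [Fintype W]

theorem two_mul_le_of_stripe_isContained_stripeExtension [Fintype ι] {A : ι → Finset W}
    {x : ι → ℕ} {j : ι} {n : ℕ} (h : (stripe n).2 ⊑ stripeExtension A x j) :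
    2 * n ≤ #(A j) + 2 * x j := by
  let weight : W ⊕ (Σ i, Fin (x i)) → ℕ :=
    Sum.elim (fun a => if a ∈ A j then 1 else 0) fun z => if z.1 = j then 2 else 0
  have hweight (u v) (huv : (stripeExtension A x j).Adj u v) : 2 ≤ weight u + weight v := by
    rcases ((fromRel_adj ..).1 huv).2 with
      (⟨a, ha, b, hb, rfl, rfl⟩ | ⟨k, rfl⟩) | (⟨a, ha, b, hb, rfl, rfl⟩ | ⟨k, rfl⟩) <;>
    simp [weight, *]
  have hnew : ∑ z : Σ i, Fin (x i), (if z.1 = j then 2 else 0) = 2 * x j := by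
    rw [Fintype.sum_sigma, sum_eq_single j (fun i _ hi => by simp [hi]) (by simp)]
    simp [mul_comm]
  refine (two_mul_le_sum_of_stripe_isContained weight hweight h).trans_eq ?_
  simp [weight, hnew]

theorem not_arrows_star_stripe_of_cliques [Fintype ι] {t : κ → ℕ} {n : ι → ℕ}
    (ht : ∀ k, 0 < t k) (G : κ → SimpleGraph W) (A : ι → Finset W)
    (hcov : ∀ a b, a ≠ b → (∃ k, (G k).Adj a b) ∨ ∃ j, a ∈ A j ∧ b ∈ A j)
    (hG : ∀ k a, (G k).degree a < t k) (hA : ∀ j, #(A j) / 2 < n j)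
    (hV : Fintype.card V ≤ Fintype.card W + ∑ j, (n j - 1 - #(A j) / 2)) :
    ¬ Arrows (⊤ : SimpleGraph V)
      (Sum.elim (fun k => star_S (t k)) (fun j => stripe (n j))) := by
  let x (j : ι) : ℕ := n j - 1 - #(A j) / 2
  let H : κ ⊕ ι → SimpleGraph (W ⊕ Σ j, Fin (x j)) :=
    Sum.elim (fun k => G k ⊕g ⊥) (stripeExtension A x)
  have hH : ⨆ i, H i = ⊤ := by
    refine eq_top_iff.2 ?_
    rintro (a | z) (b | z') hab <;> rw [iSup_adj]
    · rcases hcov a b fun h => hab (congrArg _ h) with ⟨k, hk⟩ | ⟨j, ha, hb⟩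
      · exact ⟨Sum.inl k, hk⟩
      · exact ⟨Sum.inr j, (fromRel_adj ..).2 ⟨hab, Or.inl (Or.inl ⟨a, ha, b, hb, rfl, rfl⟩)⟩⟩
    · exact ⟨Sum.inr z'.1, (stripeExtension_adj_inr z' hab.symm).symm⟩
    · exact ⟨Sum.inr z.1, stripeExtension_adj_inr z hab⟩
    · exact ⟨Sum.inr z.1, stripeExtension_adj_inr z hab⟩
  intro h
  obtain ⟨k | j, hi⟩ := arrows_top_iff.1 (h.of_card_le (by simpa [x] using hV)) H hH
  · obtain ⟨v, hv⟩ := star_isContained_iff.1 hi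
    refine hv.not_gt ?_
    rcases v with a | z
    · exact degree_sum_inl.trans_lt (hG k a)
    · exact degree_sum_inr.trans_lt ((bot_degree z).trans_lt (ht k))
  · have := two_mul_le_of_stripe_isContained_stripeExtension hi
    have := hA j
    dsimp only [x] at *
    omega

theorem not_arrows_star_stripe_of_not_arrows_star [Fintype ι] {t : κ → ℕ} {n : ι → ℕ}
    (ht : ∀ k, 0 < t k) (hn : ∀ j, 0 < n j)
    (hW : ¬ Arrows (⊤ : SimpleGraph W) fun k => star_S (t k))
    (hV : Fintype.card V ≤ Fintype.card W + ∑ j, (n j - 1)) :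
    ¬ Arrows (⊤ : SimpleGraph V)
      (Sum.elim (fun k => star_S (t k)) (fun j => stripe (n j))) := by
  simp only [arrows_top_iff, not_forall, not_exists, exists_prop, star_isContained_iff,
    not_le] at hW
  obtain ⟨G, hG, hdeg⟩ := hW
  refine not_arrows_star_stripe_of_cliques ht G (fun _ => ∅) (fun a b hab => Or.inl ?_) hdeg
    (by simpa using hn) (by simpa using hV)
  rwa [← iSup_adj, hG, top_adj]

theorem not_arrows_star_stripe_of_card_le_add_sum [Fintype ι] {t : κ → ℕ} {n : ι → ℕ}
    (ht : ∀ k, 0 < t k) (hn : ∀ j, 0 < n j) (i : ι)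
    (hV : Fintype.card V ≤ n i + ∑ j, (n j - 1)) :
    ¬ Arrows (⊤ : SimpleGraph V)
      (Sum.elim (fun k => star_S (t k)) (fun j => stripe (n j))) := by
  have hpos := hn i
  let A : ι → Finset (Fin (2 * n i - 1)) := Function.update (fun _ => ∅) i univ
  have hAi : #(A i) / 2 = n i - 1 := by
    simp only [A, Function.update_self, card_univ, Fintype.card_fin]
    omega
  have hA (j : ι) (hj : j ≠ i) : #(A j) / 2 = 0 := by simp [A, hj]
  refine not_arrows_star_stripe_of_cliques ht (fun _ => ⊥) A (fun a b _ => Or.inr ⟨i, by simp [A]⟩)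
    (fun k a => by simpa using ht k) (fun j => ?_) ?_
  · rcases eq_or_ne j i with rfl | hj
    · omega
    · rw [hA j hj]
      exact hn j
  · rw [← add_sum_erase _ _ (mem_univ i), hAi,
      sum_congr rfl fun j hj => by rw [hA j (ne_of_mem_erase hj), Nat.sub_zero], Fintype.card_fin]
    rw [← add_sum_erase _ _ (mem_univ i)] at hV
    omega

theorem degree_crossFactor_le {B : Type} [AddGroup B] [Fintype B] (k : B) (u : Option (B ⊕ B)) :
    (crossFactor k).degree u ≤ 1 := by
  rw [← card_neighborFinset_eq_degree, card_le_one]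
  simp only [mem_neighborFinset, crossFactor_adj]
  rintro v ⟨x, y, rfl, ⟨rfl, rfl⟩ | ⟨rfl, rfl⟩⟩ w ⟨x', y', h, ⟨hx, rfl⟩ | ⟨rfl, hx⟩⟩ <;>
  simp_all

theorem not_arrows_star_stripe_of_two_cliques [Fintype κ] [Fintype ι] {t : κ → ℕ} {n : ι → ℕ}
    {m : ℕ} (ht : ∀ k, 0 < t k) (hn : ∀ j, 0 < n j) {i i' : ι} (hii' : i ≠ i') (hm : 0 < m)
    (hS : 2 * m ≤ ∑ k, (t k - 1)) (hi : m < n i) (hi' : m < n i')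
    (hV : Fintype.card V ≤ 2 * m + 1 + ∑ j, (n j - 1)) :
    ¬ Arrows (⊤ : SimpleGraph V)
      (Sum.elim (fun k => star_S (t k)) (fun j => stripe (n j))) := by
  let B := ZMod (2 * m)
  have : NeZero (2 * m) := ⟨by omega⟩
  have hB : Fintype.card B = 2 * m := ZMod.card _
  obtain ⟨G, hG, hdeg⟩ := exists_iSup_eq_of_card_le_sum (degree_crossFactor_le (B := B))
    (fun k => t k - 1) (by rwa [hB])
  -- Two cliques of `2 * m + 1` vertices that share the vertex `none`.
  let A : ι → Finset (Option (B ⊕ B)) := Function.update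
    (Function.update (fun _ => ∅) i' (insertNone (disjSum ∅ univ))) i (insertNone (disjSum univ ∅))
  have hAi : #(A i) / 2 = m := by
    simp only [A, Function.update_self, card_insertNone, card_disjSum, card_empty, card_univ, hB]
    omega
  have hAi' : #(A i') / 2 = m := by
    simp only [A, Function.update_of_ne hii'.symm, Function.update_self, card_insertNone,
      card_disjSum, card_empty, card_univ, hB]
    omega
  have hA (j : ι) (hj : j ≠ i) (hj' : j ≠ i') : #(A j) / 2 = 0 := by simp [A, hj, hj']
  refine not_arrows_star_stripe_of_cliques ht G A (fun a b hab => ?_)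
    (fun k a => (hdeg k a).trans_lt (by rw [one_mul]; exact Nat.sub_lt (ht k) one_pos))
    (fun j => ?_) ?_
  · have hcross (x y : B) : ∃ k, (G k).Adj (some (Sum.inl x)) (some (Sum.inr y)) := by
      rw [← iSup_adj, hG, iSup_adj]
      exact ⟨x + y, crossFactor_adj.2 ⟨x, y, rfl, Or.inl ⟨rfl, rfl⟩⟩⟩
    rcases a with _ | x | x <;> rcases b with _ | y | y
    · exact absurd rfl hab
    · exact Or.inr ⟨i, by simp [A]⟩
    · exact Or.inr ⟨i', by simp [A, hii'.symm]⟩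
    · exact Or.inr ⟨i, by simp [A]⟩
    · exact Or.inr ⟨i, by simp [A]⟩
    · exact Or.inl (hcross x y)
    · exact Or.inr ⟨i', by simp [A, hii'.symm]⟩
    · exact Or.inl ((hcross y x).imp fun k hk => hk.symm)
    · exact Or.inr ⟨i', by simp [A, hii'.symm]⟩
  · rcases eq_or_ne j i with rfl | hj
    · rwa [hAi]
    rcases eq_or_ne j i' with rfl | hj'
    · rwa [hAi']
    · rw [hA j hj hj']
      exact hn j
  · have hi'_mem : i' ∈ univ.erase i := mem_erase.2 ⟨hii'.symm, mem_univ _⟩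
    have hrest : ∑ j ∈ (univ.erase i).erase i', (n j - 1 - #(A j) / 2) =
        ∑ j ∈ (univ.erase i).erase i', (n j - 1) := sum_congr rfl fun j hj => by
      rw [hA j (ne_of_mem_erase (mem_of_mem_erase hj)) (ne_of_mem_erase hj), Nat.sub_zero]
    rw [← add_sum_erase _ _ (mem_univ i), ← add_sum_erase _ _ hi'_mem] at hV ⊢
    rw [hAi, hAi', hrest, Fintype.card_option, Fintype.card_sum, hB]
    omega

theorem ramseyNumber_star_stripe_of_even_sum [Fintype κ] [Fintype ι] {t : κ → ℕ} {n : ι → ℕ}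
    {i₀ : ι} (ht : ∀ k, 0 < t k) (hn : ∀ i, 0 < n i) (hi₀ : ∀ i, n i ≤ n i₀)
    (hS : Even (∑ k, (t k - 1))) (hteven : ∃ k, Even (t k)) (hni₀ : n i₀ ≤ ∑ k, (t k - 1))
    (hni : ∀ i ≠ i₀, 2 * n i ≤ ∑ k, (t k - 1)) :
    ramseyNumber (Sum.elim (fun k => star_S (t k)) fun i => stripe (n i)) =
      ∑ k, (t k - 1) + ∑ i, (n i - 1) + 1 := by
  refine ramseyNumber_eq_succ ?_ ?_
  · refine arrows_star_stripe_of_even_sum hi₀ ?_ ?_ hS hteven hni₀ hni <;> rw [Fintype.card_fin]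
    omega
  · exact not_arrows_star_stripe_of_not_arrows_star (W := Fin (∑ k, (t k - 1))) ht hn
      (not_arrows_star_of_even ht hS hteven (by simp)) (by simp)

theorem ramseyNumber_star_stripe [Fintype κ] [Fintype ι] {t : κ → ℕ} {n : ι → ℕ}
    {i₀ : ι} (ht : ∀ k, 0 < t k) (hn : ∀ i, 0 < n i) (hi₀ : ∀ i, n i ≤ n i₀)
    (h : Even (∑ k, (t k - 1)) → (∃ k, Even (t k)) → n i₀ ≤ ∑ k, (t k - 1) →
      ∃ i ≠ i₀, ∑ k, (t k - 1) < 2 * n i) :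
    ramseyNumber (Sum.elim (fun k => star_S (t k)) fun i => stripe (n i)) =
      max (∑ k, (t k - 1) + 1) (n i₀) + ∑ i, (n i - 1) + 1 := by
  refine ramseyNumber_eq_succ (arrows_star_stripe hi₀ ?_ ?_) ?_
  · rw [Fintype.card_fin]
    omega
  · rw [Fintype.card_fin]
    omega
  rcases lt_or_ge (∑ k, (t k - 1)) (n i₀) with hlt | hle
  · refine not_arrows_star_stripe_of_card_le_add_sum ht hn i₀ ?_
    rw [Fintype.card_fin, max_eq_right hlt]
  rw [max_eq_left (hle.trans (Nat.le_succ _))]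
  by_cases hex : Even (∑ k, (t k - 1)) ∧ ∃ k, Even (t k)
  · obtain ⟨i, hi, hlt⟩ := h hex.1 hex.2 hle
    obtain ⟨m, hm⟩ := hex.1.two_dvd
    have := hn i₀
    have := hi₀ i
    refine not_arrows_star_stripe_of_two_cliques (m := m) ht hn hi ?_ ?_ ?_ ?_ ?_ <;>
    first | omega | rw [Fintype.card_fin, hm]
  · exact not_arrows_star_stripe_of_not_arrows_star (W := Fin (∑ k, (t k - 1) + 1)) ht hn
      (not_arrows_star ht hex (by simp)) (by simp)

end Fintype

end Ramsey

theorem secondEntry_eq_sup_erase {c : ℕ} {n : Fin c → ℕ} (hc : 0 < c) (hn : Antitone n) :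
    secondEntry n = (Finset.univ.erase ⟨0, hc⟩).sup n := by
  rw [secondEntry]
  split_ifs with h
  · refine le_antisymm (Finset.le_sup (f := n) (b := ⟨1, h⟩) (by simp))
      (Finset.sup_le fun j hj => hn ?_)
    exact Nat.one_le_iff_ne_zero.2 fun h0 => Finset.ne_of_mem_erase hj (Fin.ext h0)
  · refine ((Finset.sup_eq_bot_iff _ _).2 fun j hj => ?_).symm
    exact absurd (Fin.ext (by lia)) (Finset.ne_of_mem_erase hj)

theorem theorem2_general {κ ι : Type} [Fintype κ] [Fintype ι] [DecidableEq ι] (t : κ → ℕ)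
    (n : ι → ℕ) (i₀ : ι) (ht : ∀ k, 0 < t k) (hn : ∀ i, 0 < n i) (hi₀ : ∀ i, n i ≤ n i₀) :
    (ramseyNumber (Sum.elim (fun k => star_S (t k)) (fun i => stripe (n i))) : ℤ) =
      max ((ramseyNumber (fun k => star_S (t k)) : ℤ) +
            (if (∑ k, (t k - 1)) < max (n i₀) (2 * (Finset.univ.erase i₀).sup n) ∧
                Even (∑ k, (t k - 1)) ∧ ∃ k, Even (t k) then 0 else -1))
          (n i₀ : ℤ) + ∑ i, ((n i : ℤ) - 1) + 1 := by
  have hsum : ∑ i, ((n i : ℤ) - 1) = (∑ i, (n i - 1) : ℕ) := by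
    rw [Nat.cast_sum]
    exact Finset.sum_congr rfl fun i _ => (Nat.cast_pred (hn i)).symm
  have hsup : ∑ k, (t k - 1) < max (n i₀) (2 * (Finset.univ.erase i₀).sup n) ↔
      (n i₀ ≤ ∑ k, (t k - 1) → ∃ i ≠ i₀, ∑ k, (t k - 1) < 2 * n i) := by
    rw [Finset.mul_sup₀, lt_max_iff, Finset.lt_sup_iff, ← not_le, ← imp_iff_not_or]
    simp only [Finset.mem_erase, Finset.mem_univ, and_true, ne_eq]
  simp only [hsum, ramseyNumber_star ht, hsup]
  by_cases heven : Even (∑ k, (t k - 1)) ∧ ∃ k, Even (t k)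
  · by_cases h : n i₀ ≤ ∑ k, (t k - 1) → ∃ i ≠ i₀, ∑ k, (t k - 1) < 2 * n i
    · rw [if_pos heven, if_pos ⟨h, heven⟩, ramseyNumber_star_stripe ht hn hi₀ fun _ _ => h]
      omega
    · rw [if_pos heven, if_neg fun h' => h h'.1]
      push Not at h
      rw [ramseyNumber_star_stripe_of_even_sum ht hn hi₀ heven.1 heven.2 h.1 h.2]
      have := h.1
      omega
  · rw [if_neg heven, if_neg fun h' => heven h'.2,
      ramseyNumber_star_stripe ht hn hi₀ fun h h' => absurd ⟨h, h'⟩ heven]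
    omega

theorem theorem2 (s c : ℕ) (hc : 0 < c) (t : Fin s → ℕ) (n : Fin c → ℕ)
    (ht : ∀ i, 0 < t i) (hn : ∀ i, 0 < n i) (hmono : Antitone n)
    (S : ℕ) (hS : S = ∑ i, (t i - 1))
    (r : ℕ) (hr : r = ramseyNumber (fun i => star_S (t i)))
    (δ : ℤ) (hδ : δ = if S < max (n ⟨0, hc⟩) (2 * secondEntry n) ∧ Even S ∧ ∃ i, Even (t i)
      then 0 else -1) :
    (ramseyNumber (Sum.elim (fun i => star_S (t i)) (fun j => stripe (n j))) : ℤ) =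
      max ((r : ℤ) + δ) (n ⟨0, hc⟩ : ℤ) + ∑ j, ((n j : ℤ) - 1) + 1 := by
  rw [hδ, hr, hS, secondEntry_eq_sup_erase hc hmono]
  convert theorem2_general t n ⟨0, hc⟩ ht hn fun i => hmono (Nat.zero_le _)
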